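/- Let $F_2$ be the free group with free generators $T_1,T_2$ and identity $e$, acting on $X=\{-1,1\}^{F_2}$ by the shift, $(gx)^h=x^{g^{-1}h}$, and let $m$ be the Bernoulli measure on $X$ (the product of the uniform measures on $\{-1,1\}$). A \emph{colouring rule} on $(X,m)$ with finite set of colours $A$ consists of finitely many $m$-preserving maps $x\mapsto x_1,\dots,x\mapsto x_k$ (the \emph{descendants}), with $x_i\neq x$ for all $i$ and $m$-almost every $x$, and a correspondence $F:X\times A^k\to 2^A$ whose graph is measurable (with respect to the completion of $m$ on $X$). A colouring $c:X\to A$ \emph{satisfies} the rule if $c(x)\in F(x,c(x_1),\dots,c(x_k))$ for $m$-almost every $x$. The rule is \emph{paradoxical} if some colouring satisfies it, and for every finitely additive measure $\mu$, defined on an algebra $\mathcal A$ of subsets of $X$ that contains the Borel sets, which extends $m$ and is preserved by all the descendants (the preimage of a set $S\in\mathcal A$ under a descendant lies in $\mathcal A$ and has $\mu$-measure $\mu(S)$), no colouring $c$ that satisfies the rule is $\mu$-measurable (that is, has $c^{-1}(D)\in\mathcal A$ for all $D\subseteq A$). Consider the following rule with the four descendants $T_1x,\,T_2x,\,T_1^{-1}x,\,T_2^{-1}x$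 and the four colours $a_{i,q}$, where $i\in\{1,2\}$ is the active part and $q\in\{c,u\}$ (crowded or uncrowded) is the passive part. A point $x$ of active colour $i$ directs an arrow to $T_ix$ if $x^e=1$, and to $T_i^{-1}x$ if $x^e=-1$. If, of the two points $T_1^{x^e}x$ and $T_2^{x^e}x$ toward which $x$ can direct its arrow, one has passive colour $c$ and the other has passive colour $u$, then the arrow must be directed toward the one with passive colour $u$; otherwise either direction is allowed. The passive colour of $x$ must be $c$ if two or more of the arrows from its four neighbours are directed toward $x$, and must be $u$ otherwise. This is a colouring rule, and it is paradoxical. -/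

import Mathlib

open MeasureTheory

/-- The data of a colouring rule on `X` with colours `A`: finitely many descendants
`desc i x` (indexed by a finite type `ι`) of every point `x`, and the correspondence
`allowed : X × A^ι → 2^A` of colours permitted at `x`, given the colours of the descendants. -/
structure RuleData (X A ι : Type*) where
  desc : ι → X → X
  allowed : X → (ι → A) → Set A

namespace RuleData

variable {X A ι : Type*} [MeasurableSpace X] [MeasurableSpace A]

/-- The data form a colouring rule on the probability space `(X, m)`. -/
structure IsColouringRule (R : RuleData X A ι) (m : Measure X) : Prop where
  isProbabilityMeasure : IsProbabilityMeasure m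
  /-- there are finitely many descendants -/
  finite : Finite ι
  /-- almost everywhere, no point is a descendant of itself -/
  irreflexive : ∀ᵐ x ∂m, ∀ i, R.desc i x ≠ x
  /-- the descendants are measure preserving transformations -/
  measurePreserving : ∀ i, MeasurePreserving (R.desc i) m m
  /-- the graph of the correspondence is measurable, where `X` carries the completion of its
  `σ`-algebra with respect to `m` -/
  measurable_graph :
    MeasurableSet {p : NullMeasurableSpace X m × (ι → A) × A | p.2.2 ∈ R.allowed p.1 p.2.1}

/-- The colouring `c` obeys the rule at almost every point. -/
def Satisfies (R : RuleData X A ι) (m : Measure X) (c : X → A) : Prop :=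
  ∀ᵐ x ∂m, c x ∈ R.allowed x (fun i => c (R.desc i x))

/-- `μ`, a finitely additive measure on the algebra of sets `𝒜`, extends `m`, and all the
descendants are measure preserving with respect to `μ`. -/
structure IsInvariantExtension (R : RuleData X A ι) (m : Measure X) (𝒜 : Set (Set X))
    (μ : AddContent ENNReal 𝒜) : Prop where
  isSetAlgebra : IsSetAlgebra 𝒜
  mem_of_measurableSet : ∀ s, MeasurableSet s → s ∈ 𝒜
  eq_of_measurableSet : ∀ s, MeasurableSet s → μ s = m s
  preimage_mem : ∀ i, ∀ s ∈ 𝒜, R.desc i ⁻¹' s ∈ 𝒜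
  preimage_eq : ∀ i, ∀ s ∈ 𝒜, μ (R.desc i ⁻¹' s) = μ s

/-- Some colouring satisfies the rule almost everywhere, but, for every finitely additive
extension of `m` which the descendants preserve, no such colouring is measurable. -/
def IsParadoxical (R : RuleData X A ι) (m : Measure X) : Prop :=
  (∃ c : X → A, R.Satisfies m c) ∧
    ∀ (𝒜 : Set (Set X)) (μ : AddContent ENNReal 𝒜), R.IsInvariantExtension m 𝒜 μ →
      ¬ ∃ c : X → A, R.Satisfies m c ∧ ∀ D : Set A, MeasurableSet D → c ⁻¹' D ∈ 𝒜

end RuleData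

/-- The space `{-1, 1} ^ F₂`; here `ℤˣ = {-1, 1}`. -/
abbrev ShiftSpace : Type := FreeGroup (Fin 2) → ℤˣ

/-- The product of the uniform probability measures on `{-1, 1}`. -/
noncomputable def bernoulliMeasure : Measure ShiftSpace :=
  Measure.infinitePi fun _ => (PMF.uniformOfFintype ℤˣ).toMeasure

/-- The shift action of `F₂` (a left action). -/
def shift (g : FreeGroup (Fin 2)) (x : ShiftSpace) : ShiftSpace :=
  fun h => x (g⁻¹ * h)

/-- The neighbour `T_i ^ s x` of `x`, for `p = (i, s)` with `s = 1` or `s = -1`. -/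
def neighbour (p : Fin 2 × ℤˣ) (x : ShiftSpace) : ShiftSpace :=
  shift (FreeGroup.of p.1 ^ (p.2 : ℤ)) x

/-- The four colours: the active part is the index `i` of the generator along which the arrow
is directed; the passive part is `true` for crowded and `false` for uncrowded. -/
abbrev ArrowColour : Type := Fin 2 × Bool

/-- If `b` gives the colours of the four neighbours of `x`, the number of arrows directed toward
`x`: the arrow from `y = T_i ^ s x` leads to `T_j ^ (y^e) y`, with `j` the active colour of `y`,
so it is directed toward `x` when `y^e = -s` and `j = i`. -/
def arrowsToward (x : ShiftSpace) (b : Fin 2 × ℤˣ → ArrowColour) : ℕ :=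
  (Finset.univ.filter fun p : Fin 2 × ℤˣ =>
    neighbour p x 1 = -p.2 ∧ (b p).1 = p.1).card

/-- The arrow rule. The arrow from `x` goes to `T_0 ^ s x` or `T_1 ^ s x` with `s = x^e`; if one
of these is uncrowded and the other crowded, it must go to the uncrowded one. The point `x` is
crowded if and only if at least two arrows are directed toward it. -/
def arrowRule : RuleData ShiftSpace ArrowColour (Fin 2 × ℤˣ) where
  desc := neighbour
  allowed x b :=
    {a | (∀ i j : Fin 2, (b (i, x 1)).2 = false → (b (j, x 1)).2 = true → a.1 = i) ∧
      (a.2 = true ↔ 2 ≤ arrowsToward x b)}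

/-! ### Counting inequalities for finitely additive measures -/

/-! A satisfying colouring comes from the axiom of choice: almost every orbit is a copy of the
Cayley tree of the free group, and arrows directed away from a chosen base point never meet, so no
point is crowded (`exists_satisfies_arrowRule`).

Measurability fails by mass transport (`not_exists_measurable_satisfies`). Let γ be the measure of
the crowded points, h the mass of arrows into them, and b the mass of points both of whose potential
targets are crowded. Each point sends one arrow, uncrowded points receive at most one, and a set of
measure 1/16 can receive none, so h ≥ γ + 1/16. Crowded points receive at least two arrows, so h ≥
2γ. The rule gives h ≤ b. A point has four neighbours and each point counted by b has two potential
targets, so 2b ≤ 4γ. Hence 2γ = h = b, so γ ≥ 1/16, and almost every crowded point has all four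
neighbours counted by b. Such points are very constrained: γ ≤ 1/32, a contradiction.

Each inequality integrates a pointwise count using finite additivity only
(`sum_content_le_sum_content`). -/

section Content

variable {X : Type*} {𝒜 : Set (Set X)}

/-- The points which lie in exactly those members of the family `A` whose index is in `T`. -/
def familyAtom {κ : Type*} (A : κ → Set X) (T : Set κ) : Set X :=
  {x | ∀ k, x ∈ A k ↔ k ∈ T}

theorem familyAtom_mem {κ : Type*} [Fintype κ] (h𝒜 : IsSetAlgebra 𝒜) {A : κ → Set X}
    (hA : ∀ k, A k ∈ 𝒜) (T : Set κ) : familyAtom A T ∈ 𝒜 := by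
  classical
  have h : familyAtom A T = ⋂ k ∈ (Finset.univ : Finset κ), if k ∈ T then A k else (A k)ᶜ := by
    ext x
    simp only [familyAtom, Set.mem_ofPred_eq, Set.mem_iInter, Finset.mem_univ, true_imp_iff]
    refine forall_congr' fun k => ?_
    by_cases hk : k ∈ T <;> simp [hk]
  rw [h]
  refine h𝒜.biInter_mem _ fun k _ => ?_
  split_ifs
  · exact hA k
  · exact h𝒜.compl_mem (hA k)

-- The finitely many atoms generated by the family partition the space, so a comparison of sums of
-- contents reduces to a comparison of coefficients on each atom. Removing `N` keeps only atoms that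
-- contain a point where the pointwise hypothesis is available.
open Classical in
theorem content_eq_sum_familyAtom {κ : Type*} [Fintype κ] (h𝒜 : IsSetAlgebra 𝒜)
    (μ : AddContent ENNReal 𝒜) {A : κ → Set X} (hA : ∀ k, A k ∈ 𝒜) {N : Set X} (hN : N ∈ 𝒜)
    (hμN : μ N = 0) (k : κ) :
    μ (A k) = ∑ T : Set κ, if k ∈ T then μ (familyAtom A T \ N) else 0 := by
  have hd : μ (A k) = μ (A k \ N) := by
    refine le_antisymm ?_ (addContent_mono h𝒜.isSetRing.isSetSemiring
      (h𝒜.sdiff_mem (hA k) hN) (hA k) Set.sdiff_subset)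
    calc μ (A k) ≤ μ (A k \ N ∪ N) := addContent_mono h𝒜.isSetRing.isSetSemiring (hA k)
          (h𝒜.union_mem (h𝒜.sdiff_mem (hA k) hN) hN) (by simp)
      _ ≤ μ (A k \ N) + μ N :=
          addContent_union_le h𝒜.isSetRing (h𝒜.sdiff_mem (hA k) hN) hN
      _ = μ (A k \ N) := by rw [hμN, add_zero]
  have hu : A k \ N = ⋃ T ∈ (Finset.univ.filter fun T : Set κ => k ∈ T), familyAtom A T \ N := by
    ext x
    simp only [familyAtom, Finset.mem_filter, Finset.mem_univ, true_and, Set.mem_iUnion,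
      Set.mem_sdiff, Set.mem_ofPred_eq, exists_prop]
    constructor
    · rintro ⟨hx, hn⟩
      exact ⟨{j | x ∈ A j}, hx, fun j => Iff.rfl, hn⟩
    · rintro ⟨T, hT, h, hn⟩
      exact ⟨(h k).2 hT, hn⟩
  rw [hd, hu, addContent_biUnion_eq h𝒜.isSetRing
    (fun T _ => h𝒜.sdiff_mem (familyAtom_mem h𝒜 hA T) hN), Finset.sum_filter]
  intro T _ T' _ hTT'
  refine Set.disjoint_left.2 fun x hx hx' => hTT' ?_
  ext j
  exact (hx.1 j).symm.trans (hx'.1 j)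

open Classical in
/-- If, off a null set, every point lies in at most as many members of the family `s` as of the
family `t`, then the contents of the members of `s` add up to at most those of `t`. -/
theorem sum_content_le_sum_content {ι κ : Type*} [Fintype ι] [Fintype κ] (h𝒜 : IsSetAlgebra 𝒜)
    (μ : AddContent ENNReal 𝒜) {N : Set X} (hN : N ∈ 𝒜) (hμN : μ N = 0)
    {s : ι → Set X} {t : κ → Set X} (hs : ∀ i, s i ∈ 𝒜) (ht : ∀ k, t k ∈ 𝒜)
    (h : ∀ x ∉ N, ∑ i, (s i).indicator (1 : X → ℕ) x ≤ ∑ k, (t k).indicator (1 : X → ℕ) x) :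
    ∑ i, μ (s i) ≤ ∑ k, μ (t k) := by
  have hA : ∀ k : ι ⊕ κ, Sum.elim s t k ∈ 𝒜 := by
    rintro (i | k)
    exacts [hs i, ht k]
  have key := content_eq_sum_familyAtom h𝒜 μ hA hN hμN
  have h1 : ∀ i, μ (s i) = _ := fun i => key (Sum.inl i)
  have h2 : ∀ k, μ (t k) = _ := fun k => key (Sum.inr k)
  simp_rw [h1, h2]
  rw [Finset.sum_comm, Finset.sum_comm (s := (Finset.univ : Finset κ))]
  refine Finset.sum_le_sum fun T _ => ?_
  rcases (familyAtom (Sum.elim s t) T \ N).eq_empty_or_nonempty with he | ⟨x, hx, hxN⟩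
  · simp [he]
  · have h3 := h x hxN
    have hi : ∀ i, x ∈ s i ↔ Sum.inl i ∈ T := fun i => hx (Sum.inl i)
    have hk : ∀ k, x ∈ t k ↔ Sum.inr k ∈ T := fun k => hx (Sum.inr k)
    simp only [Set.indicator_apply, Pi.one_apply, hi, hk] at h3
    have h4 : ((∑ i, if Sum.inl i ∈ T then 1 else 0 : ℕ) : ENNReal)
        ≤ ((∑ k, if Sum.inr k ∈ T then 1 else 0 : ℕ) : ENNReal) := by exact_mod_cast h3
    push_cast at h4
    have h5 := mul_le_mul_left h4 (μ (familyAtom (Sum.elim s t) T \ N))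
    simpa only [Finset.sum_mul, ite_mul, one_mul, zero_mul] using h5

end Content

/-! ### Words in free groups -/

theorem FreeGroup.toWord_mk_singleton_mul {α : Type*} [DecidableEq α] (a : α × Bool)
    (h : FreeGroup α) (ha : h.toWord.head? ≠ some (a.1, !a.2)) :
    (FreeGroup.mk [a] * h).toWord = a :: h.toWord := by
  conv_lhs => rw [← FreeGroup.mk_toWord (x := h)]
  rw [FreeGroup.mul_mk, FreeGroup.toWord_mk, List.singleton_append, FreeGroup.reduce.cons,
    FreeGroup.reduce_toWord]
  rcases hw : h.toWord with _ | ⟨b, l⟩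
  · rfl
  · rw [hw] at ha
    have : ¬ (a.1 = b.1 ∧ a.2 = !b.2) := by
      rintro ⟨h1, h2⟩
      apply ha
      simp [h1, h2]
    simp [this]

theorem of_zpow_eq_mk {α : Type*} (i : α) (s : ℤˣ) :
    FreeGroup.of i ^ (s : ℤ) = FreeGroup.mk [(i, decide (s = 1))] := by
  rcases Int.units_eq_one_or s with rfl | rfl
  · simp [FreeGroup.of]
  · simp [FreeGroup.of, FreeGroup.invRev]

theorem norm_of_zpow_mul {α : Type*} [DecidableEq α] (i : α) (s : ℤˣ) (h : FreeGroup α)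
    (hh : h.toWord.head? ≠ some (i, !decide (s = 1))) :
    (FreeGroup.of i ^ (s : ℤ) * h).norm = h.norm + 1 := by
  rw [of_zpow_eq_mk, FreeGroup.norm, FreeGroup.toWord_mk_singleton_mul _ _ hh]
  rfl

/-- At most one of the neighbours of a vertex of the Cayley tree is nearer to the identity. -/
theorem eq_of_norm_of_zpow_mul_lt {α : Type*} [DecidableEq α] {i j : α} {s t : ℤˣ}
    {h : FreeGroup α} (hi : (FreeGroup.of i ^ (s : ℤ) * h).norm < h.norm)
    (hj : (FreeGroup.of j ^ (t : ℤ) * h).norm < h.norm) : i = j ∧ s = t := by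
  -- The norm can drop only by cancelling the first letter of the reduced word, and that letter
  -- determines both the generator and the sign.
  have h1 : h.toWord.head? = some (i, !decide (s = 1)) := by
    by_contra hc
    have := norm_of_zpow_mul i s h hc
    omega
  have h2 : h.toWord.head? = some (j, !decide (t = 1)) := by
    by_contra hc
    have := norm_of_zpow_mul j t h hc
    omega
  rw [h1] at h2
  simp only [Option.some.injEq, Prod.mk.injEq] at h2
  refine ⟨h2.1, ?_⟩
  rcases Int.units_eq_one_or s with rfl | rfl <;> rcases Int.units_eq_one_or t with rfl | rfl <;>
    simp_all

/-- In either direction, one of the two generators leads away from the identity. -/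
theorem exists_norm_lt_norm_of_zpow_mul (s : ℤˣ) (h : FreeGroup (Fin 2)) :
    ∃ i : Fin 2, h.norm < (FreeGroup.of i ^ (s : ℤ) * h).norm := by
  by_cases h0 : h.toWord.head? = some (0, !decide (s = 1))
  · refine ⟨1, ?_⟩
    rw [norm_of_zpow_mul]
    · omega
    · rw [h0]
      simp
  · exact ⟨0, by rw [norm_of_zpow_mul _ _ _ h0]; omega⟩

/-! ### The shift action and its Bernoulli measure -/

theorem shift_mul (g h : FreeGroup (Fin 2)) (x : ShiftSpace) :
    shift (g * h) x = shift g (shift h x) := by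
  funext k
  simp [shift, mul_assoc]

theorem shift_one (x : ShiftSpace) : shift 1 x = x := by
  funext k
  simp [shift]

theorem neighbour_apply (p : Fin 2 × ℤˣ) (x : ShiftSpace) (g : FreeGroup (Fin 2)) :
    neighbour p x g = x (FreeGroup.of p.1 ^ ((-p.2 : ℤˣ) : ℤ) * g) := by
  simp [neighbour, shift]

theorem neighbour_neg_neighbour (i : Fin 2) (s : ℤˣ) (x : ShiftSpace) :
    neighbour (i, -s) (neighbour (i, s) x) = x := by
  simp only [neighbour, ← shift_mul]
  simp [shift_one]

instance : MeasurableSingletonClass ℤˣ where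
  measurableSet_singleton a := ⟨{(a : ℤ)}, measurableSet_singleton _, by ext; simp [Units.ext_iff]⟩

theorem uniform_units_singleton (a : ℤˣ) :
    (PMF.uniformOfFintype ℤˣ).toMeasure {a} = 2⁻¹ := by
  rw [PMF.toMeasure_apply_singleton _ _ (measurableSet_singleton a)]
  simp

instance : IsProbabilityMeasure bernoulliMeasure := by
  unfold bernoulliMeasure
  infer_instance

theorem bernoulliMeasure_cylinder (S : Finset (FreeGroup (Fin 2)))
    (f : FreeGroup (Fin 2) → ℤˣ) :
    bernoulliMeasure {x | ∀ g ∈ S, x g = f g} = 2⁻¹ ^ S.card := by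
  have h : {x : ShiftSpace | ∀ g ∈ S, x g = f g} = Set.pi S fun g => {f g} := by
    ext x
    simp [Set.mem_pi]
  rw [h, bernoulliMeasure, Measure.infinitePi_pi _ fun g _ => measurableSet_singleton (f g)]
  simp only [uniform_units_singleton, Finset.prod_const]

theorem measurableSet_cylinder (g : FreeGroup (Fin 2)) (a : ℤˣ) :
    MeasurableSet {x : ShiftSpace | x g = a} :=
  (measurable_pi_apply (X := fun _ => ℤˣ) g) (measurableSet_singleton a)

theorem measurePreserving_shift (g : FreeGroup (Fin 2)) :
    MeasurePreserving (shift g) bernoulliMeasure bernoulliMeasure := by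
  refine ⟨measurable_pi_lambda _ fun h => measurable_pi_apply _, ?_⟩
  have := Measure.infinitePi_map_piCongrLeft
    (μ := fun _ : FreeGroup (Fin 2) => (PMF.uniformOfFintype ℤˣ).toMeasure) (Equiv.mulLeft g)
  have h2 : shift g = ⇑(MeasurableEquiv.piCongrLeft (fun _ => ℤˣ) (Equiv.mulLeft g)) := by
    funext x h
    rw [MeasurableEquiv.coe_piCongrLeft]
    have := Equiv.piCongrLeft_apply_apply (fun _ => ℤˣ) (Equiv.mulLeft g) x (g⁻¹ * h)
    simpa [shift] using this.symm
  rw [h2]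
  exact this

/-- Almost every point has a trivial stabilizer. -/
theorem ae_shift_ne : ∀ᵐ x ∂bernoulliMeasure, ∀ g : FreeGroup (Fin 2), g ≠ 1 → shift g x ≠ x := by
  have : Countable (FreeGroup (Fin 2)) := by
    exact Quot.mk_surjective.countable
  rw [ae_all_iff]
  intro g
  by_cases hg : g = 1
  · simp [hg]
  suffices h : bernoulliMeasure {x | shift g x = x} = 0 by
    rw [ae_iff]
    simpa [hg] using h
  -- A fixed point of `g` is constant along the powers of `g`, which are distinct because free
  -- groups are torsion-free. It therefore lies in one of two cylinders on `n` coordinates, for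
  -- every `n`.
  have hinj : Function.Injective fun n : ℕ => g ^ n :=
    injective_pow_iff_not_isOfFinOrder.2 (not_isOfFinOrder_of_isMulTorsionFree hg)
  have hb : ∀ n : ℕ, bernoulliMeasure {x | shift g x = x} ≤ 2 * 2⁻¹ ^ n := by
    intro n
    let S := (Finset.range n).image fun k => g ^ k
    have hS : S.card = n := by
      rw [Finset.card_image_of_injective _ hinj, Finset.card_range]
    have hsub : {x : ShiftSpace | shift g x = x} ⊆
        {x | ∀ k ∈ S, x k = (fun _ => 1) k} ∪ {x | ∀ k ∈ S, x k = (fun _ => -1) k} := by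
      intro x hx
      have hc : ∀ k : ℕ, x (g ^ k) = x 1 := by
        intro k
        induction k with
        | zero => simp
        | succ k ih =>
          rw [← ih]
          have := congrFun (show shift g x = x from hx) (g ^ (k + 1))
          rw [← this]
          simp [shift, pow_succ']
      rcases Int.units_eq_one_or (x 1) with h | h
      · left
        intro k hk
        obtain ⟨j, _, rfl⟩ := Finset.mem_image.1 hk
        exact (hc j).trans h
      · right
        intro k hk
        obtain ⟨j, _, rfl⟩ := Finset.mem_image.1 hk
        exact (hc j).trans h
    calc _ ≤ _ := measure_mono hsub
      _ ≤ _ := measure_union_le _ _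
      _ = 2 * 2⁻¹ ^ n := by
        rw [bernoulliMeasure_cylinder, bernoulliMeasure_cylinder, hS, two_mul]
  have hlim : Filter.Tendsto (fun n : ℕ => (2 : ENNReal) * 2⁻¹ ^ n) Filter.atTop (nhds 0) := by
    have := ENNReal.Tendsto.const_mul (a := 2)
      (ENNReal.tendsto_pow_atTop_nhds_zero_of_lt_one (r := 2⁻¹) (by simp)) (Or.inr (by simp))
    simpa using this
  exact le_antisymm (ge_of_tendsto' hlim hb) zero_le

theorem arrowRule_isColouringRule : arrowRule.IsColouringRule bernoulliMeasure where
  isProbabilityMeasure := inferInstance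
  finite := inferInstance
  irreflexive := by
    filter_upwards [ae_shift_ne] with x hx p
    refine hx _ ?_
    rw [of_zpow_eq_mk, ne_eq, ← FreeGroup.norm_eq_zero]
    simp [FreeGroup.norm]
  measurePreserving p := measurePreserving_shift _
  measurable_graph := by
    -- There are finitely many colour patterns, so the graph is a finite union of rectangles. Each
    -- base depends only on the values at the identity of the point and of its four neighbours.
    have h : {p : NullMeasurableSpace ShiftSpace bernoulliMeasure ×
        (Fin 2 × ℤˣ → ArrowColour) × ArrowColour | p.2.2 ∈ arrowRule.allowed p.1 p.2.1} =
        ⋃ q : (Fin 2 × ℤˣ → ArrowColour) × ArrowColour,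
          {x : NullMeasurableSpace ShiftSpace bernoulliMeasure |
            q.2 ∈ arrowRule.allowed x q.1} ×ˢ {q} := by
      ext ⟨x, q⟩
      simp
    rw [h]
    refine MeasurableSet.iUnion fun q => MeasurableSet.prod ?_ (measurableSet_singleton q)
    refine MeasurableSet.nullMeasurableSet (α := ShiftSpace) ?_
    have hn : ∀ p : Fin 2 × ℤˣ, Measurable fun x : ShiftSpace => neighbour p x 1 := fun p => by
      simp only [neighbour_apply]
      exact measurable_pi_apply _
    have hf : Measurable fun x : ShiftSpace => (x 1, fun p => neighbour p x 1) :=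
      (measurable_pi_apply 1).prodMk (measurable_pi_lambda _ hn)
    exact hf (MeasurableSet.of_discrete (s := {w : ℤˣ × (Fin 2 × ℤˣ → ℤˣ) |
      (∀ i j : Fin 2, (q.1 (i, w.1)).2 = false → (q.1 (j, w.1)).2 = true → q.2.1 = i) ∧
      (q.2.2 = true ↔ 2 ≤ (Finset.univ.filter fun p : Fin 2 × ℤˣ =>
        w.2 p = -p.2 ∧ (q.1 p).1 = p.1).card)}))

/-! ### A colouring that satisfies the rule -/

theorem shift_inv_shift (g : FreeGroup (Fin 2)) (x : ShiftSpace) : shift g⁻¹ (shift g x) = x := by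
  rw [← shift_mul, inv_mul_cancel, shift_one]

theorem exists_orbit_representative :
    ∃ (r : ShiftSpace → ShiftSpace) (γ : ShiftSpace → FreeGroup (Fin 2)),
      (∀ x, shift (γ x) (r x) = x) ∧ ∀ g x, r (shift g x) = r x := by
  let S : Setoid ShiftSpace :=
    { r := fun x y => ∃ g, shift g x = y
      iseqv :=
        { refl := fun x => ⟨1, shift_one x⟩
          symm := by
            rintro x _ ⟨g, rfl⟩
            exact ⟨g⁻¹, shift_inv_shift g x⟩
          trans := by
            rintro x _ _ ⟨g, rfl⟩ ⟨h, rfl⟩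
            exact ⟨h * g, shift_mul h g x⟩ } }
  have h : ∀ x : ShiftSpace, ∃ g, shift g (Quotient.mk S x).out = x := fun x =>
    Quotient.exact (Quotient.out_eq (Quotient.mk S x))
  choose γ hγ using h
  refine ⟨fun x => (Quotient.mk S x).out, γ, hγ, fun g x => ?_⟩
  have : Quotient.mk S (shift g x) = Quotient.mk S x :=
    (Quotient.sound (s := S) ⟨g, rfl⟩ : Quotient.mk S x = Quotient.mk S (shift g x)).symm
  simp only [this]

/-- Directing all arrows away from a chosen base point of every orbit yields a colouring without
crowded points. -/
theorem exists_satisfies_arrowRule :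
    ∃ c : ShiftSpace → ArrowColour, arrowRule.Satisfies bernoulliMeasure c := by
  obtain ⟨r, γ, hγ, hr⟩ := exists_orbit_representative
  choose a ha using fun x : ShiftSpace => exists_norm_lt_norm_of_zpow_mul (x 1) (γ x)
  refine ⟨fun x => (a x, false), ?_⟩
  filter_upwards [ae_shift_ne] with x hx
  -- On a free orbit the position relative to the base point is unique, hence equivariant.
  have hstep : ∀ g, γ (shift g x) = g * γ x := by
    intro g
    by_contra hne
    have h1 : shift (γ (shift g x)) (r x) = shift g x := by
      rw [← hr g x]
      exact hγ _
    have h2 : shift (g⁻¹ * γ (shift g x) * (γ x)⁻¹) x = x := by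
      have h0 : shift (γ x)⁻¹ x = r x := by
        have := shift_inv_shift (γ x) (r x)
        rwa [hγ x] at this
      rw [shift_mul, h0, shift_mul, h1, shift_inv_shift]
    refine hx _ (fun h => hne ?_) h2
    rw [mul_inv_eq_one] at h
    rw [← h, mul_inv_cancel_left]
  refine ⟨fun i j _ h => by simp at h, iff_of_false (by simp) ?_⟩
  rw [not_le]
  refine Nat.lt_succ_of_le (Finset.card_le_one.2 ?_)
  -- Arrows lead away from the base point, so an arrow into `x` can come only from a neighbour
  -- nearer to it, and there is at most one.
  have key : ∀ p : Fin 2 × ℤˣ, neighbour p x 1 = -p.2 → a (neighbour p x) = p.1 →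
      (FreeGroup.of p.1 ^ (p.2 : ℤ) * γ x).norm < (γ x).norm := by
    intro p h1 h2
    have h3 := ha (neighbour p x)
    rw [h1, h2] at h3
    have h4 : γ (neighbour p x) = FreeGroup.of p.1 ^ (p.2 : ℤ) * γ x := hstep _
    rw [h4] at h3
    simpa using h3
  intro p hp q hq
  simp only [Finset.mem_filter, Finset.mem_univ, true_and] at hp hq
  exact Prod.ext_iff.2 (eq_of_norm_of_zpow_mul_lt (key p hp.1 hp.2) (key q hq.1 hq.2))

/-! ### No such colouring is measurable with respect to an invariant extension -/

/-- No arrow can be directed toward these points. -/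
def noPotentialArrow : Set ShiftSpace := {x | ∀ p : Fin 2 × ℤˣ, neighbour p x 1 = p.2}

/-- All four neighbours of these points may direct their arrows toward them. -/
def allPotentialArrows : Set ShiftSpace := {x | ∀ p : Fin 2 × ℤˣ, neighbour p x 1 = -p.2}

/-- The map to the other end of the edge of potential arrows from `T₀ x`. -/
def acrossEdge (x : ShiftSpace) : ShiftSpace := neighbour (1, -1) (neighbour (0, 1) x)

theorem bernoulliMeasure_noPotentialArrow : bernoulliMeasure noPotentialArrow = 2⁻¹ ^ 4 := by
  have h : noPotentialArrow = {x | ∀ g ∈ ({FreeGroup.of 0, (FreeGroup.of 0)⁻¹, FreeGroup.of 1,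
      (FreeGroup.of 1)⁻¹} : Finset (FreeGroup (Fin 2))),
      x g = (fun g => if g = FreeGroup.of 0 ∨ g = FreeGroup.of 1 then -1 else 1) g} := by
    have h1 : (FreeGroup.of (0 : Fin 2))⁻¹ ≠ FreeGroup.of 0 := by decide
    have h2 : (FreeGroup.of (0 : Fin 2))⁻¹ ≠ FreeGroup.of 1 := by decide
    have h3 : (FreeGroup.of (1 : Fin 2))⁻¹ ≠ FreeGroup.of 0 := by decide
    have h4 : (FreeGroup.of (1 : Fin 2))⁻¹ ≠ FreeGroup.of 1 := by decide
    ext x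
    simp only [noPotentialArrow, neighbour_apply, Set.mem_ofPred_eq, Prod.forall, Fin.forall_fin_two]
    constructor
    · rintro ⟨h5, h6⟩
      have := h5 1
      have := h5 (-1)
      have := h6 1
      have := h6 (-1)
      simp_all
    · intro h
      simp only [Finset.mem_insert, Finset.mem_singleton, forall_eq_or_imp, forall_eq, h1, h2, h3,
        h4, or_self, or_true, true_or, if_true, if_false] at h
      constructor <;> intro s <;> rcases Int.units_eq_one_or s with rfl | rfl <;> simp_all
  rw [h, bernoulliMeasure_cylinder]
  congr 1

/-- The first set fixes four coordinates. One further coordinate from the second set already brings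
the bound below the 1/16 of `noPotentialArrow`, which is all that is needed. -/
theorem bernoulliMeasure_allPotentialArrows_inter_le :
    bernoulliMeasure (allPotentialArrows ∩ acrossEdge ⁻¹' allPotentialArrows) ≤ 2⁻¹ ^ 5 := by
  let f : FreeGroup (Fin 2) → ℤˣ := fun g =>
    if g = (FreeGroup.of 0)⁻¹ ∨ g = (FreeGroup.of 1)⁻¹ then -1 else 1
  let S : Finset (FreeGroup (Fin 2)) := {FreeGroup.of 0, (FreeGroup.of 0)⁻¹, FreeGroup.of 1,
    (FreeGroup.of 1)⁻¹, (FreeGroup.of 0)⁻¹ * FreeGroup.of 1 * FreeGroup.of 1}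
  have hS : S.card = 5 := by decide
  rw [← hS, ← bernoulliMeasure_cylinder S f]
  refine measure_mono ?_
  rintro x ⟨hx, hy⟩ g hg
  have h1 := hx (0, 1)
  have h2 := hx (0, -1)
  have h3 := hx (1, 1)
  have h4 := hx (1, -1)
  have h5 := hy (1, -1)
  simp only [acrossEdge, neighbour_apply] at h1 h2 h3 h4 h5
  simp only [S, Finset.mem_insert, Finset.mem_singleton] at hg
  rcases hg with rfl | rfl | rfl | rfl | rfl
  · have : f (FreeGroup.of 0) = 1 := by decide
    simpa [this] using h2
  · have : f (FreeGroup.of 0)⁻¹ = -1 := by decide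
    simpa [this] using h1
  · have : f (FreeGroup.of 1) = 1 := by decide
    simpa [this] using h4
  · have : f (FreeGroup.of 1)⁻¹ = -1 := by decide
    simpa [this] using h3
  · have : f ((FreeGroup.of 0)⁻¹ * FreeGroup.of 1 * FreeGroup.of 1) = 1 := by decide
    rw [this]
    simpa [mul_assoc] using h5

theorem measurableSet_neighbour_apply_eq (p : Fin 2 × ℤˣ) (a : ℤˣ) :
    MeasurableSet {x : ShiftSpace | neighbour p x 1 = a} := by
  simp only [neighbour_apply]
  exact measurableSet_cylinder _ _

theorem measurableSet_noPotentialArrow : MeasurableSet noPotentialArrow := by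
  have : noPotentialArrow = ⋂ p : Fin 2 × ℤˣ, {x | neighbour p x 1 = p.2} := by
    ext x
    simp [noPotentialArrow]
  rw [this]
  exact MeasurableSet.iInter fun p => measurableSet_neighbour_apply_eq p p.2

theorem measurableSet_allPotentialArrows : MeasurableSet allPotentialArrows := by
  have : allPotentialArrows = ⋂ p : Fin 2 × ℤˣ, {x | neighbour p x 1 = -p.2} := by
    ext x
    simp [allPotentialArrows]
  rw [this]
  exact MeasurableSet.iInter fun p => measurableSet_neighbour_apply_eq p (-p.2)

/-! ### Arrows into crowded points, counted at their source and at their target. -/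

section Colouring

variable (c : ShiftSpace → ArrowColour)

/-- The crowded points. -/
def crowded : Set ShiftSpace := {x | (c x).2 = true}

/-- The points whose arrow leads from them to their neighbour `T_i ^ (-s)`, where `p = (i, s)`. -/
def arrowAgainst (p : Fin 2 × ℤˣ) : Set ShiftSpace := {y | y 1 = -p.2 ∧ (c y).1 = p.1}

/-- The points of `arrowAgainst c p` whose arrow leads to a crowded point. -/
def crowdedArrowAgainst (p : Fin 2 × ℤˣ) : Set ShiftSpace :=
  arrowAgainst c p ∩ neighbour (p.1, -p.2) ⁻¹' crowded c

/-- The points `y` with `y^e = t` both of whose potential targets are crowded. -/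
def bothCrowded (t : ℤˣ) : Set ShiftSpace :=
  {y | y 1 = t} ∩ (neighbour (0, t) ⁻¹' crowded c ∩ neighbour (1, t) ⁻¹' crowded c)

variable {c}

theorem mem_bothCrowded {t : ℤˣ} {y : ShiftSpace} :
    y ∈ bothCrowded c t ↔ y 1 = t ∧ ∀ i, neighbour (i, t) y ∈ crowded c := by
  simp [bothCrowded, Fin.forall_fin_two]

/-- An arrow may lead to a crowded point only if both potential targets are crowded. -/
theorem mem_bothCrowded_of_mem_crowdedArrowAgainst {y : ShiftSpace}
    (hy : c y ∈ arrowRule.allowed y fun i => c (arrowRule.desc i y)) {p : Fin 2 × ℤˣ}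
    (hp : y ∈ crowdedArrowAgainst c p) : y ∈ bothCrowded c (-p.2) := by
  obtain ⟨⟨h1, h2⟩, h3⟩ := hp
  refine mem_bothCrowded.2 ⟨h1, fun i => ?_⟩
  by_contra hi
  have h4 := hy.1 i p.1 (by rw [h1]; exact Bool.eq_false_iff.2 hi) (by rw [h1]; exact h3)
  rw [h2] at h4
  exact hi (h4 ▸ h3)

theorem sum_indicator_arrowAgainst (x : ShiftSpace) :
    ∑ p : Fin 2 × ℤˣ, (neighbour p ⁻¹' arrowAgainst c p).indicator (1 : ShiftSpace → ℕ) x =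
      arrowsToward x fun i => c (neighbour i x) := by
  classical
  rw [arrowsToward, Finset.card_filter]
  refine Finset.sum_congr rfl fun p _ => ?_
  rw [Set.indicator_apply]
  exact if_congr Iff.rfl rfl rfl

theorem mem_preimage_crowdedArrowAgainst {p : Fin 2 × ℤˣ} {x : ShiftSpace} :
    x ∈ neighbour p ⁻¹' crowdedArrowAgainst c p ↔
      x ∈ neighbour p ⁻¹' arrowAgainst c p ∧ x ∈ crowded c := by
  simp only [crowdedArrowAgainst, Set.mem_preimage, Set.mem_inter_iff]
  rw [show neighbour (p.1, -p.2) (neighbour p x) = x from neighbour_neg_neighbour p.1 p.2 x]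

theorem sum_indicator_crowdedArrowAgainst {x : ShiftSpace} (hx : x ∈ crowded c) :
    ∑ p : Fin 2 × ℤˣ, (neighbour p ⁻¹' crowdedArrowAgainst c p).indicator (1 : ShiftSpace → ℕ) x =
      arrowsToward x fun i => c (neighbour i x) := by
  classical
  rw [← sum_indicator_arrowAgainst]
  refine Finset.sum_congr rfl fun p _ => ?_
  rw [Set.indicator_apply, Set.indicator_apply]
  exact if_congr (mem_preimage_crowdedArrowAgainst.trans (and_iff_left hx)) rfl rfl

theorem arrowsToward_eq_zero {x : ShiftSpace} (hx : x ∈ noPotentialArrow)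
    (b : Fin 2 × ℤˣ → ArrowColour) : arrowsToward x b = 0 := by
  rw [arrowsToward, Finset.card_eq_zero, Finset.filter_eq_empty_iff]
  rintro p - ⟨h, -⟩
  rw [hx p] at h
  rcases Int.units_eq_one_or p.2 with h1 | h1 <;> rw [h1] at h <;> revert h <;> decide

/-- The two potential targets of `T₀ x` are `x` itself and `acrossEdge x`, so crowding propagates
across the edge. -/
theorem mem_of_forall_mem_bothCrowded {x : ShiftSpace}
    (h : ∀ p : Fin 2 × ℤˣ, x ∈ neighbour p ⁻¹' bothCrowded c (-p.2)) :
    x ∈ allPotentialArrows ∩ acrossEdge ⁻¹' crowded c :=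
  ⟨fun p => (mem_bothCrowded.1 (h p)).1, (mem_bothCrowded.1 (h (0, 1))).2 1⟩

theorem mem_crowded_of_mem_bothCrowded {x : ShiftSpace} {p : Fin 2 × ℤˣ}
    (h : x ∈ neighbour p ⁻¹' bothCrowded c (-p.2)) : x ∈ crowded c := by
  have := (mem_bothCrowded.1 h).2 p.1
  rwa [show neighbour (p.1, -p.2) (neighbour p x) = x from neighbour_neg_neighbour p.1 p.2 x]
    at this

end Colouring

theorem not_exists_measurable_satisfies {𝒜 : Set (Set ShiftSpace)} {μ : AddContent ENNReal 𝒜}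
    (hμ : arrowRule.IsInvariantExtension bernoulliMeasure 𝒜 μ) {c : ShiftSpace → ArrowColour}
    (hc : arrowRule.Satisfies bernoulliMeasure c)
    (hcm : ∀ D : Set ArrowColour, MeasurableSet D → c ⁻¹' D ∈ 𝒜) : False := by
  classical
  have hA := hμ.isSetAlgebra
  have hpre : ∀ p, ∀ s ∈ 𝒜, neighbour p ⁻¹' s ∈ 𝒜 := hμ.preimage_mem
  have heq : ∀ p, ∀ s ∈ 𝒜, μ (neighbour p ⁻¹' s) = μ s := hμ.preimage_eq
  have hval : ∀ t : ℤˣ, {y : ShiftSpace | y 1 = t} ∈ 𝒜 := fun t =>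
    hμ.mem_of_measurableSet _ (measurableSet_cylinder 1 t)
  have hC : crowded c ∈ 𝒜 := hcm {a | a.2 = true} MeasurableSet.of_discrete
  have hD : ∀ p, arrowAgainst c p ∈ 𝒜 := fun p =>
    hA.inter_mem (hval (-p.2)) (hcm {a | a.1 = p.1} MeasurableSet.of_discrete)
  have hH : ∀ p, crowdedArrowAgainst c p ∈ 𝒜 := fun p => hA.inter_mem (hD p) (hpre _ _ hC)
  have hB : ∀ t, bothCrowded c t ∈ 𝒜 := fun t =>
    hA.inter_mem (hval t) (hA.inter_mem (hpre _ _ hC) (hpre _ _ hC))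
  have hZ := hμ.mem_of_measurableSet _ measurableSet_noPotentialArrow
  have hW := hμ.mem_of_measurableSet _ measurableSet_allPotentialArrows
  have hacross : ∀ s ∈ 𝒜, acrossEdge ⁻¹' s ∈ 𝒜 := fun s hs => hpre (0, 1) _ (hpre (1, -1) _ hs)
  have hacross_eq : ∀ s ∈ 𝒜, μ (acrossEdge ⁻¹' s) = μ s := fun s hs =>
    (heq (0, 1) _ (hpre (1, -1) _ hs)).trans (heq (1, -1) _ hs)
  let V := allPotentialArrows ∩ acrossEdge ⁻¹' crowded c
  have hV : crowded c \ V ∈ 𝒜 := hA.sdiff_mem hC (hA.inter_mem hW (hacross _ hC))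
  have hCW : crowded c \ allPotentialArrows ∈ 𝒜 := hA.sdiff_mem hC hW
  have hWW : allPotentialArrows ∩ acrossEdge ⁻¹' allPotentialArrows ∈ 𝒜 :=
    hA.inter_mem hW (hacross _ hW)
  have huniv : μ Set.univ = 1 := by
    rw [hμ.eq_of_measurableSet _ MeasurableSet.univ, measure_univ]
  -- The exceptional set itself need not belong to `𝒜`; a Borel null set containing it does.
  obtain ⟨N, hN, hNm, hN0⟩ := exists_measurable_superset_of_null (ae_iff.1 hc)
  have hN𝒜 := hμ.mem_of_measurableSet N hNm
  have hμN : μ N = 0 := (hμ.eq_of_measurableSet N hNm).trans hN0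
  have hrule : ∀ x ∉ N, c x ∈ arrowRule.allowed x fun i => c (arrowRule.desc i x) :=
    fun x hx => by_contra fun h => hx (hN h)
  have hcrowd : ∀ x ∉ N, (x ∈ crowded c ↔ 2 ≤ arrowsToward x fun i => c (neighbour i x)) :=
    fun x hx => (hrule x hx).2
  -- every point directs an arrow
  have i1 : (1 : ENNReal) ≤ ∑ p, μ (arrowAgainst c p) := by
    have := sum_content_le_sum_content hA μ hN𝒜 hμN (s := fun _ : Unit => Set.univ)
      (t := arrowAgainst c) (fun _ => hA.univ_mem) hD ?_
    · simpa [huniv] using this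
    · intro x _
      have hx : x ∈ arrowAgainst c ((c x).1, -x 1) := by simp [arrowAgainst]
      refine le_trans ?_ (Finset.single_le_sum (fun _ _ => Nat.zero_le _)
        (Finset.mem_univ ((c x).1, -x 1)))
      simp [hx]
  -- uncrowded points receive at most one arrow, or none if there is no potential arrow
  have i2 : ∑ p, μ (arrowAgainst c p) + (μ noPotentialArrow + μ (crowded c)) ≤
      1 + ∑ p, μ (crowdedArrowAgainst c p) := by
    have := sum_content_le_sum_content hA μ hN𝒜 hμN
      (s := Sum.elim (fun p => neighbour p ⁻¹' arrowAgainst c p)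
        (fun b : Bool => if b then noPotentialArrow else crowded c))
      (t := Sum.elim (fun _ : Unit => Set.univ)
        (fun p => neighbour p ⁻¹' crowdedArrowAgainst c p)) ?_ ?_ ?_
    · simpa [huniv, heq, hD, hH] using this
    · rintro (p | b | b)
      exacts [hpre _ _ (hD p), hC, hZ]
    · rintro (u | p)
      exacts [hA.univ_mem, hpre _ _ (hH p)]
    · intro x hx
      have h1 := hcrowd x hx
      simp only [Fintype.sum_sum_type, Sum.elim_inl, Sum.elim_inr, sum_indicator_arrowAgainst,
        Fintype.sum_bool, if_true, Bool.false_eq_true, if_false, Finset.univ_unique,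
        Finset.sum_singleton, Set.indicator_univ, Pi.one_apply]
      by_cases hz : x ∈ noPotentialArrow
      · have h0 := arrowsToward_eq_zero hz fun i => c (neighbour i x)
        have hnc : x ∉ crowded c := by rw [h1, h0]; decide
        rw [h0, Set.indicator_of_mem hz, Set.indicator_of_notMem hnc, Pi.one_apply]
        omega
      · rw [Set.indicator_of_notMem hz]
        by_cases hcx : x ∈ crowded c
        · rw [sum_indicator_crowdedArrowAgainst hcx, Set.indicator_of_mem hcx, Pi.one_apply]
          omega
        · rw [Set.indicator_of_notMem hcx]
          rw [h1] at hcx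
          omega
  -- crowded points receive at least two arrows
  have i3 : 2 * μ (crowded c) ≤ ∑ p, μ (crowdedArrowAgainst c p) := by
    have := sum_content_le_sum_content hA μ hN𝒜 hμN (s := fun _ : Fin 2 => crowded c)
      (t := fun p => neighbour p ⁻¹' crowdedArrowAgainst c p) (fun _ => hC)
      (fun p => hpre _ _ (hH p)) ?_
    · simpa [heq, hH] using this
    · intro x hx
      by_cases hcx : x ∈ crowded c
      · rw [sum_indicator_crowdedArrowAgainst hcx]
        simpa [hcx] using (hcrowd x hx).1 hcx
      · simp [hcx]
  -- A point directs only one arrow, and if that arrow obeys the rule and ends at a crowded point,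
  -- the alternative target is crowded too.
  have i4 : ∑ p, μ (crowdedArrowAgainst c p) ≤ ∑ t, μ (bothCrowded c t) := by
    refine sum_content_le_sum_content hA μ hN𝒜 hμN hH hB fun x hx => ?_
    by_cases h : ∃ p, x ∈ crowdedArrowAgainst c p
    · obtain ⟨p, hp⟩ := h
      have h1 : ∀ q, x ∈ crowdedArrowAgainst c q → q = p := fun q hq =>
        Prod.ext (hq.1.2.symm.trans hp.1.2) (neg_injective (hq.1.1.symm.trans hp.1.1))
      rw [Finset.sum_eq_single p (fun q _ hq => Set.indicator_of_notMem (fun h => hq (h1 q h)) _) (by simp)]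
      refine le_trans ?_ (Finset.single_le_sum (fun _ _ => Nat.zero_le _)
        (Finset.mem_univ (-p.2)))
      simp [mem_bothCrowded_of_mem_crowdedArrowAgainst (hrule x hx) hp, hp]
    · push Not at h
      simp [h]
  -- Each point of `bothCrowded` is counted at both of its potential targets, which are crowded and
  -- have four neighbours each. Outside `V` at least one of the four neighbours does not count,
  -- which leaves room for the extra term.
  have i5 : 2 * ∑ t, μ (bothCrowded c t) + μ (crowded c \ V) ≤ 4 * μ (crowded c) := by
    have := sum_content_le_sum_content hA μ hN𝒜 hμN
      (s := Sum.elim (fun p => neighbour p ⁻¹' bothCrowded c (-p.2))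
        (fun _ : Unit => crowded c \ V))
      (t := fun _ : Fin 4 => crowded c) ?_ (fun _ => hC) ?_
    · have h2 : ∑ p : Fin 2 × ℤˣ, μ (bothCrowded c (-p.2)) = 2 * ∑ t, μ (bothCrowded c t) := by
        rw [Fintype.sum_prod_type]
        simp only [Finset.sum_const, Finset.card_univ, Fintype.card_fin, nsmul_eq_mul]
        exact congrArg (2 * ·) (Equiv.sum_comp (Equiv.neg ℤˣ) fun t => μ (bothCrowded c t))
      simpa [heq, hB, h2] using this
    · rintro (p | u)
      exacts [hpre _ _ (hB _), hV]
    · intro x _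
      simp only [Fintype.sum_sum_type, Sum.elim_inl, Sum.elim_inr, Finset.univ_unique,
        Finset.sum_const, Finset.card_singleton, one_mul, Finset.card_univ, Fintype.card_fin,
        smul_eq_mul]
      by_cases hcx : x ∈ crowded c
      · simp only [Set.indicator_apply, Pi.one_apply, if_pos hcx, mul_one, ← Finset.card_filter]
        have hcard : (Finset.univ : Finset (Fin 2 × ℤˣ)).card = 4 := by decide
        by_cases hall : ∀ p : Fin 2 × ℤˣ, x ∈ neighbour p ⁻¹' bothCrowded c (-p.2)
        · have hxV : x ∈ V := mem_of_forall_mem_bothCrowded hall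
          rw [if_neg fun h => h.2 hxV, add_zero, ← hcard]
          exact Finset.card_filter_le _ _
        · push Not at hall
          obtain ⟨p, hp⟩ := hall
          have := Finset.card_lt_card (Finset.filter_ssubset
            (p := fun p : Fin 2 × ℤˣ => x ∈ neighbour p ⁻¹' bothCrowded c (-p.2)).2
            ⟨p, Finset.mem_univ _, hp⟩)
          split_ifs <;> omega
      · have h1 : ∀ p : Fin 2 × ℤˣ, x ∉ neighbour p ⁻¹' bothCrowded c (-p.2) := fun p hp =>
          hcx (mem_crowded_of_mem_bothCrowded hp)
        simp [h1, hcx]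
  have i6 : μ (crowded c \ allPotentialArrows) ≤ μ (crowded c \ V) :=
    addContent_mono hA.isSetRing.isSetSemiring hCW hV
      (Set.sdiff_subset_sdiff_right Set.inter_subset_left)
  -- For a crowded point in `V` the point across the edge is crowded as well, so it also lies in
  -- `allPotentialArrows` unless it belongs to the defect `crowded c \ V`. The defect is thus paid
  -- at both ends of the edge.
  have i7 : μ (crowded c) ≤ 2⁻¹ ^ 5 + (μ (crowded c \ V) + μ (crowded c \ V)) := by
    have hsub : crowded c ⊆ (allPotentialArrows ∩ acrossEdge ⁻¹' allPotentialArrows) ∪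
        ((crowded c \ V) ∪ acrossEdge ⁻¹' (crowded c \ allPotentialArrows)) := by
      intro x hx
      by_cases h1 : x ∈ V
      · by_cases h2 : acrossEdge x ∈ allPotentialArrows
        · exact Or.inl ⟨h1.1, h2⟩
        · exact Or.inr (Or.inr ⟨h1.2, h2⟩)
      · exact Or.inr (Or.inl ⟨hx, h1⟩)
    refine (addContent_mono hA.isSetRing.isSetSemiring hC
      (hA.union_mem hWW (hA.union_mem hV (hacross _ hCW))) hsub).trans ?_
    refine (addContent_union_le hA.isSetRing hWW (hA.union_mem hV (hacross _ hCW))).trans ?_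
    refine add_le_add ?_ ?_
    · rw [hμ.eq_of_measurableSet _ (measurableSet_allPotentialArrows.inter ?_)]
      · exact bernoulliMeasure_allPotentialArrows_inter_le
      · exact ((measurePreserving_shift _).measurable.comp
          (measurePreserving_shift _).measurable) measurableSet_allPotentialArrows
    · refine (addContent_union_le hA.isSetRing hV (hacross _ hCW)).trans ?_
      rw [hacross_eq _ hCW]
      gcongr
  rw [hμ.eq_of_measurableSet _ measurableSet_noPotentialArrow,
    bernoulliMeasure_noPotentialArrow] at i2
  have hle : ∀ s ∈ 𝒜, μ s ≠ ⊤ := fun s hs =>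
    ne_top_of_le_ne_top (huniv ▸ ENNReal.one_ne_top)
      (addContent_mono hA.isSetRing.isSetSemiring hs hA.univ_mem (Set.subset_univ s))
  have fC := hle _ hC
  have fV := hle _ hV
  have fH : ∑ p, μ (crowdedArrowAgainst c p) ≠ ⊤ := ENNReal.sum_ne_top.2 fun p _ => hle _ (hH p)
  have fB : ∑ t, μ (bothCrowded c t) ≠ ⊤ := ENNReal.sum_ne_top.2 fun t _ => hle _ (hB t)
  have i8 := (add_le_add_left i1 (2⁻¹ ^ 4 + μ (crowded c))).trans i2
  generalize μ (crowded c \ V) = δ at *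
  generalize μ (crowded c) = γ at *
  generalize ∑ p, μ (crowdedArrowAgainst c p) = h at *
  generalize ∑ t, μ (bothCrowded c t) = b at *
  lift δ to NNReal using fV
  lift γ to NNReal using fC
  lift h to NNReal using fH
  lift b to NNReal using fB
  have e : (2⁻¹ : ENNReal) = ((2⁻¹ : NNReal) : ENNReal) := by simp
  rw [e] at i7 i8
  norm_cast at i3 i4 i5 i7 i8
  rw [← NNReal.coe_le_coe] at i3 i4 i5 i7 i8
  push_cast at i3 i4 i5 i7 i8
  norm_num at i7 i8
  -- Here 4γ + δ ≤ 2h + δ ≤ 2b + δ ≤ 4γ forces δ = 0 and h = 2γ. Then `i8` gives γ ≥ 1/16, while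
  -- `i7` gives γ ≤ 1/32.
  have := δ.coe_nonneg
  linarith

theorem mainTheorem3 :
    arrowRule.IsColouringRule bernoulliMeasure ∧ arrowRule.IsParadoxical bernoulliMeasure :=
  ⟨arrowRule_isColouringRule, exists_satisfies_arrowRule,
    fun _ _ hμ ⟨_, hc, hcm⟩ => not_exists_measurable_satisfies hμ hc hcm⟩
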